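/- Let $X$ be a finite set and let $S:X\times X\to X\times X$, $S(x,y)=(g_x(y),f_y(x))$, be a non-degenerate symmetric set-theoretical solution of the Yang–Baxter equation: all maps $g_x,f_x:X\to X$ are bijective, $S\circ S=\mathrm{Id}$, and $S^{12}S^{23}S^{12}=S^{23}S^{12}S^{23}$ on $X^3$. Let $M=M(X,S)$ and $G=G(X,S)$ be the monoid and the group with presentation $\langle X\mid xy=g_x(y)f_y(x);\ x,y\in X,\ S(x,y)\neq(x,y)\rangle$. Since the relations are homogeneous, every $a\in M$ has a length $\ell_X(a)$, the length of any word on $X$ representing it. An element $f$ is a left (resp. right) divisor of $g$ in $M$ if $g=fh$ (resp. $g=hf$) for some $h\in M$. A Garside element of $M$ is an element whose sets of left and right divisors coincide and whose divisors generate $M$. Let $V$ be a real vector space with basis $X$. Let $\phi:G\to\mathfrak S(X)$, $a\mapsto\phi_a$, be the morphism with $\phi_x=f_x^{-1}$ for $x\in X$, and let $\psi:G\to GL(V)$, $a\mapsto\psi_a$, be the morphism with $\psi_x(y)=\phi_x(y)$ for $y\in X$, $y\ne x$, and $\psi_x(x)=-\phi_x(x)$; for $a\in M$, the maps $\phi_a,\psi_a$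 are those of the image of $a$ in $G$. Let $W=\psi(G)$ and $\mathbf X=\{\psi_x\mid x\in X\}$, a finite group and a subset generating it as a monoid. Let $\ell_{\mathbf X}(w)$ be the minimal length of a word on $\mathbf X$ representing $w\in W$, and for $\rho\in GL(V)$ let $n(\rho)=\#\{x\in X\mid\rho(x)\notin X\}$. If $w=vv'$ in $W$ with $\ell_{\mathbf X}(w)=\ell_{\mathbf X}(v)+\ell_{\mathbf X}(v')$, then $v$ is called a left $\mathbf X$-factor and $v'$ a right $\mathbf X$-factor of $w$; the element $w$ is $\mathbf X$-balanced if its sets of left and right $\mathbf X$-factors coincide. Then $M$ has exactly one Garside element $\Delta$ that divides every Garside element on the left and on the right. Let $\mathrm{Div}(\Delta)$ be its set of divisors. (1) For every $a\in\mathrm{Div}(\Delta)$, $\ell_X(a)=\ell_{\mathbf X}(\psi_a)=n(\psi_a)$. Moreover, for every $x\in X$, $\psi_a(x)=-\phi_a(x)$ if $x$ right divides $a$ in $M$, and $\psi_a(x)=\phi_a(x)$ otherwise. (2) The restriction of $a\mapsto\psi_a$ to $\mathrm{Div}(\Delta)$ is injective. (3) The element $\psi_\Delta$ is $\mathbf X$-balanced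 in $W$, and its set of $\mathbf X$-factors is $\{\psi_a\mid a\in\mathrm{Div}(\Delta)\}$. -/

import Mathlib

noncomputable section

/-- The length of an element `w` of a monoid with respect to a set `A`: the minimal length of
a word on `A` that represents `w`. -/
def wordLength {W : Type*} [Monoid W] (A : Set W) (w : W) : ℕ :=
  sInf {k : ℕ | ∃ l : List W, (∀ v ∈ l, v ∈ A) ∧ l.prod = w ∧ l.length = k}

/-- The left `A`-factors of `w`: those `v` with `w = v * u` and `ℓ(w) = ℓ(v) + ℓ(u)`. -/
def leftFactors {W : Type*} [Monoid W] (A : Set W) (w : W) : Set W :=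
  {v | ∃ u, w = v * u ∧ wordLength A w = wordLength A v + wordLength A u}

/-- The right `A`-factors of `w`: those `v` with `w = u * v` and `ℓ(w) = ℓ(u) + ℓ(v)`. -/
def rightFactors {W : Type*} [Monoid W] (A : Set W) (w : W) : Set W :=
  {v | ∃ u, w = u * v ∧ wordLength A w = wordLength A u + wordLength A v}

/-- `w` is `A`-balanced: its left `A`-factors and its right `A`-factors coincide. -/
def IsFactorBalanced {W : Type*} [Monoid W] (A : Set W) (w : W) : Prop :=
  leftFactors A w = rightFactors A w

/-- `f` is a left divisor of `g`. -/
def LeftDivides {M : Type*} [Monoid M] (f g : M) : Prop := ∃ h, g = f * h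

/-- `f` is a right divisor of `g`. -/
def RightDivides {M : Type*} [Monoid M] (f g : M) : Prop := ∃ h, g = h * f

/-- `d` has the same left and right divisors. -/
def IsBalanced {M : Type*} [Monoid M] (d : M) : Prop :=
  ∀ a, LeftDivides a d ↔ RightDivides a d

/-- The set of divisors of a balanced element. -/
def divisorSet {M : Type*} [Monoid M] (d : M) : Set M := {a | LeftDivides a d}

/-- A Garside element: a balanced element whose divisors generate the monoid. -/
def IsGarsideElement {M : Type*} [Monoid M] (d : M) : Prop :=
  IsBalanced d ∧ Submonoid.closure (divisorSet d) = ⊤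

/-- `d` is the minimal Garside element, for both left and right divisibility. -/
def IsMinGarsideElement {M : Type*} [Monoid M] (d : M) : Prop :=
  IsGarsideElement d ∧ ∀ e, IsGarsideElement e → LeftDivides d e ∧ RightDivides d e

/-- `S` acting on the first two components. -/
def act12 {X : Type*} (S : X × X → X × X) : X × X × X → X × X × X :=
  fun p => ((S (p.1, p.2.1)).1, (S (p.1, p.2.1)).2, p.2.2)

/-- `S` acting on the last two components. -/
def act23 {X : Type*} (S : X × X → X × X) : X × X × X → X × X × X :=
  fun p => (p.1, S p.2)

/-- A non-degenerate symmetric (that is, involutive and braided) set-theoretical solution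
`(X, S)` of the Yang-Baxter equation. Here `S (x, y) = (g x y, f y x)`. -/
structure YBSolution (X : Type*) where
  S : X × X → X × X
  bijective_g : ∀ x, Function.Bijective fun y => (S (x, y)).1
  bijective_f : ∀ y, Function.Bijective fun x => (S (x, y)).2
  involutive : ∀ p, S (S p) = p
  braided : act12 S ∘ act23 S ∘ act12 S = act23 S ∘ act12 S ∘ act23 S

namespace YBSolution

variable {X : Type*} (sol : YBSolution X)

/-- `S (x, y) = (g x y, f y x)`. -/
def g (x y : X) : X := (sol.S (x, y)).1

/-- `S (x, y) = (g x y, f y x)`. -/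
def f (y x : X) : X := (sol.S (x, y)).2

/-- The defining relations `x y = g_x(y) f_y(x)`, for `S (x, y) ≠ (x, y)`, between words. -/
def monoidRels (v w : FreeMonoid X) : Prop :=
  ∃ x y : X, sol.S (x, y) ≠ (x, y) ∧
    v = FreeMonoid.of x * FreeMonoid.of y ∧
    w = FreeMonoid.of (sol.g x y) * FreeMonoid.of (sol.f y x)

/-- The same relations, as relators of a group presentation. -/
def groupRels : Set (FreeGroup X) :=
  {r | ∃ x y : X, sol.S (x, y) ≠ (x, y) ∧
    r = FreeGroup.of x * FreeGroup.of y *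
      (FreeGroup.of (sol.g x y) * FreeGroup.of (sol.f y x))⁻¹}

/-- The monoid `M(X,S)`. -/
abbrev M : Type _ := PresentedMonoid sol.monoidRels

/-- The structure group `G(X,S)`. -/
abbrev G : Type _ := PresentedGroup sol.groupRels

/-- The element of `M(X,S)` given by an element of `X`. -/
def gen (x : X) : sol.M := PresentedMonoid.of sol.monoidRels x

theorem toG_aux (v w : FreeMonoid X) (h : sol.monoidRels v w) :
    FreeMonoid.lift (fun x => (PresentedGroup.of x : sol.G)) v =
      FreeMonoid.lift (fun x => (PresentedGroup.of x : sol.G)) w := by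
  obtain ⟨x, y, hxy, rfl, rfl⟩ := h
  simp only [map_mul, FreeMonoid.lift_eval_of]
  exact PresentedGroup.mk_eq_mk_of_mul_inv_mem ⟨x, y, hxy, rfl⟩

/-- The canonical morphism `M(X,S) → G(X,S)`, through which `φ` and `ψ` are evaluated on
elements of `M(X,S)`. -/
def toG : sol.M →* sol.G :=
  PresentedMonoid.lift (fun x => (PresentedGroup.of x : sol.G)) sol.toG_aux

theorem lengthHom_aux (v w : FreeMonoid X) (h : sol.monoidRels v w) :
    FreeMonoid.lift (fun _ : X => Multiplicative.ofAdd (1 : ℕ)) v =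
      FreeMonoid.lift (fun _ : X => Multiplicative.ofAdd (1 : ℕ)) w := by
  obtain ⟨x, y, hxy, rfl, rfl⟩ := h
  simp

/-- The length function as a morphism: every generator has length one. -/
def lengthHom : sol.M →* Multiplicative ℕ :=
  PresentedMonoid.lift (fun _ : X => Multiplicative.ofAdd (1 : ℕ)) sol.lengthHom_aux

/-- The length of an element of `M(X,S)`. -/
def len (a : sol.M) : ℕ := Multiplicative.toAdd (sol.lengthHom a)

/-- The length of an element is the length of any of its word representatives. -/
theorem len_mk (w : FreeMonoid X) :
    sol.len (PresentedMonoid.mk sol.monoidRels w) = w.toList.length := by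
  induction w with
  | one => simp [len]
  | of x => rfl
  | mul x y hx hy =>
    simp only [len, map_mul, toAdd_mul, FreeMonoid.toList_mul, List.length_append] at *
    omega

/-- `φ_x = f_x⁻¹`. -/
def phiGen (x : X) : Equiv.Perm X := (Equiv.ofBijective (sol.f x) (sol.bijective_f x)).symm

theorem phiGen_f (x y : X) : sol.phiGen x (sol.f x y) = y :=
  (Equiv.ofBijective (sol.f x) (sol.bijective_f x)).symm_apply_apply y

theorem f_phiGen (x y : X) : sol.f x (sol.phiGen x y) = y :=
  (Equiv.ofBijective (sol.f x) (sol.bijective_f x)).apply_symm_apply y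

theorem f_f (a x y : X) :
    sol.f y (sol.f x a) = sol.f (sol.f y x) (sol.f (sol.g x y) a) :=
  congrArg (fun p => p.2.2) (congrFun sol.braided (a, x, y))

theorem f_g (x y : X) : sol.f (sol.f y x) (sol.g x y) = y :=
  congrArg Prod.snd (sol.involutive (x, y))

theorem phiGen_mul (x y : X) :
    sol.phiGen x * sol.phiGen y = sol.phiGen (sol.g x y) * sol.phiGen (sol.f y x) := by
  have h : ∀ z, sol.f y (sol.f x ((sol.phiGen (sol.g x y) * sol.phiGen (sol.f y x)) z)) = z := by
    intro z
    rw [f_f, Equiv.Perm.mul_apply, f_phiGen, f_phiGen]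
  ext z
  have := h z
  conv_lhs => rw [← this]
  rw [Equiv.Perm.mul_apply, phiGen_f, phiGen_f]

theorem phi_aux (r : FreeGroup X) (h : r ∈ sol.groupRels) :
    FreeGroup.lift sol.phiGen r = 1 := by
  obtain ⟨x, y, -, rfl⟩ := h
  simp only [map_mul, map_inv, FreeGroup.lift_apply_of]
  rw [phiGen_mul, mul_inv_rev, mul_assoc, mul_inv_cancel_left, mul_inv_cancel]

/-- The morphism `φ` from `G(X,S)` to the symmetric group on `X`. -/
def phi : sol.G →* Equiv.Perm X := PresentedGroup.toGroup (f := sol.phiGen) sol.phi_aux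

section Representation

/-! `V` is a real vector space with basis (indexed by) `X`; the group `V ≃ₗ[ℝ] V` is `GL(V)`. -/

variable {V : Type*} [AddCommGroup V] [Module ℝ V] (b : Module.Basis X ℝ V)

open Classical in
/-- The linear automorphism `ψ_x`, with `ψ_x(y) = φ_x(y)` for `y ≠ x` and `ψ_x(x) = -φ_x(x)`. -/
def psiGen (x : X) : V ≃ₗ[ℝ] V :=
  b.equiv ((b.reindex (sol.phiGen x).symm).unitsSMul (fun y => if y = x then -1 else 1))
    (Equiv.refl X)

theorem psiGen_of_ne {x y : X} (h : y ≠ x) : sol.psiGen b x (b y) = b (sol.phiGen x y) := by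
  simp [psiGen, Module.Basis.unitsSMul_apply, h]

theorem psiGen_self (x : X) : sol.psiGen b x (b x) = -b (sol.phiGen x x) := by
  simp [psiGen, Module.Basis.unitsSMul_apply]

theorem psiGen_mul {x y : X} (hxy : sol.S (x, y) ≠ (x, y)) :
    sol.psiGen b x * sol.psiGen b y =
      sol.psiGen b (sol.g x y) * sol.psiGen b (sol.f y x) := by
  have hphi : ∀ z, sol.phiGen x (sol.phiGen y z) =
      sol.phiGen (sol.g x y) (sol.phiGen (sol.f y x) z) :=
    fun z => Equiv.congr_fun (sol.phiGen_mul x y) z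
  have hne : y ≠ sol.f y x := by
    intro h
    apply hxy
    have h1 : sol.f y (sol.g x y) = sol.f y x := by
      have := sol.f_g x y
      rw [← h] at this
      rw [this]; exact h
    have h2 : sol.g x y = x := (sol.bijective_f y).1 h1
    exact Prod.ext h2 h.symm
  have key1 : ∀ z, sol.phiGen y z = x ↔ z = sol.f y x := fun z =>
    ⟨fun h => by rw [← h, f_phiGen], fun h => by rw [h, phiGen_f]⟩
  have key2 : ∀ z, sol.phiGen (sol.f y x) z = sol.g x y ↔ z = y := fun z =>
    ⟨fun h => by rw [← sol.f_g x y, ← h, f_phiGen],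
      fun h => by
        have := sol.phiGen_f (sol.f y x) (sol.g x y)
        rw [f_g] at this
        rw [h, this]⟩
  apply LinearEquiv.toLinearMap_injective
  apply b.ext
  intro z
  change sol.psiGen b x (sol.psiGen b y (b z)) =
    sol.psiGen b (sol.g x y) (sol.psiGen b (sol.f y x) (b z))
  by_cases h1 : z = y
  · subst h1
    have h2 : sol.phiGen z z ≠ x := fun h => hne ((key1 z).1 h)
    rw [psiGen_self, map_neg, psiGen_of_ne _ _ h2, psiGen_of_ne _ _ hne, (key2 z).2 rfl,
      psiGen_self, hphi, (key2 z).2 rfl]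
  · have h3 : sol.phiGen (sol.f y x) z ≠ sol.g x y := fun h => h1 ((key2 z).1 h)
    rw [psiGen_of_ne _ _ h1]
    by_cases h2 : z = sol.f y x
    · rw [(key1 z).2 h2, psiGen_self]
      rw [h2] at h3
      rw [h2, psiGen_self, map_neg, psiGen_of_ne _ _ h3, ← hphi, phiGen_f]
    · rw [psiGen_of_ne _ _ (fun h => h2 ((key1 z).1 h)), psiGen_of_ne _ _ h2,
        psiGen_of_ne _ _ h3, hphi]

theorem psi_aux (r : FreeGroup X) (h : r ∈ sol.groupRels) :
    FreeGroup.lift (sol.psiGen b) r = 1 := by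
  obtain ⟨x, y, hxy, rfl⟩ := h
  simp only [map_mul, map_inv, FreeGroup.lift_apply_of]
  rw [sol.psiGen_mul b hxy, mul_inv_rev, mul_assoc, mul_inv_cancel_left, mul_inv_cancel]

/-- The linear representation `ψ` of `G(X,S)` on `V`. -/
def psi : sol.G →* (V ≃ₗ[ℝ] V) := PresentedGroup.toGroup (f := sol.psiGen b) (sol.psi_aux b)

/-- The group `W(X,S) = ψ(G(X,S))`. -/
abbrev W : Subgroup (V ≃ₗ[ℝ] V) := (sol.psi b).range

/-- For `a` in `M(X,S)`, the permutation `φ_a`. -/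
def phiM (a : sol.M) : Equiv.Perm X := sol.phi (sol.toG a)

/-- For `a` in `M(X,S)`, the element `ψ_a` of `W(X,S)`. -/
def psiM (a : sol.M) : sol.W b := (sol.psi b).rangeRestrict (sol.toG a)

/-- The generating set `{ψ_x | x ∈ X}` of `W(X,S)`. -/
def genSet : Set (sol.W b) := Set.range fun x => sol.psiM b (sol.gen x)

/-- `ψ_a(x) = ± φ_a(x)`. -/
theorem psi_apply (a : sol.G) (y : X) :
    sol.psi b a (b y) = b (sol.phi a y) ∨ sol.psi b a (b y) = -b (sol.phi a y) := by
  have hof : ∀ x : X, sol.psi b (PresentedGroup.of x) = sol.psiGen b x :=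
    fun x => PresentedGroup.toGroup.of _
  have hof' : ∀ x : X, sol.phi (PresentedGroup.of x) = sol.phiGen x :=
    fun x => PresentedGroup.toGroup.of _
  have hinv : ∀ a : sol.G,
      (∀ y, sol.psi b a (b y) = b (sol.phi a y) ∨ sol.psi b a (b y) = -b (sol.phi a y)) →
      ∀ y, sol.psi b a⁻¹ (b y) = b (sol.phi a⁻¹ y) ∨
        sol.psi b a⁻¹ (b y) = -b (sol.phi a⁻¹ y) := by
    intro a ha y
    have hc : ∀ v, sol.psi b a⁻¹ (sol.psi b a v) = v := by
      intro v
      rw [← LinearEquiv.mul_apply, ← map_mul, inv_mul_cancel, map_one, LinearEquiv.coe_one, id]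
    have hy : sol.phi a (sol.phi a⁻¹ y) = y := by
      rw [← Equiv.Perm.mul_apply, ← map_mul, mul_inv_cancel, map_one, Equiv.Perm.one_apply]
    rcases ha (sol.phi a⁻¹ y) with h | h
    · left
      have := hc (b (sol.phi a⁻¹ y))
      rwa [h, hy] at this
    · right
      have := hc (b (sol.phi a⁻¹ y))
      rw [h, hy, map_neg] at this
      rw [← this, neg_neg]
  have hx : ∀ x y : X, sol.psi b (PresentedGroup.of x) (b y) =
      b (sol.phi (PresentedGroup.of x) y) ∨
      sol.psi b (PresentedGroup.of x) (b y) = -b (sol.phi (PresentedGroup.of x) y) := by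
    intro x y
    rw [hof, hof']
    by_cases h : y = x
    · subst h
      exact Or.inr (sol.psiGen_self b y)
    · exact Or.inl (sol.psiGen_of_ne b h)
  revert y
  induction a using PresentedGroup.induction_on with | _ z
  induction z using FreeGroup.induction_on with
  | C1 => intro y; left; simp
  | of x => exact hx x
  | inv_of x h => exact hinv _ h
  | mul u v hu hv =>
    intro y
    rw [map_mul, map_mul, map_mul, LinearEquiv.mul_apply, Equiv.Perm.mul_apply]
    rcases hv y with h | h <;> rcases hu (sol.phi (PresentedGroup.mk _ v) y) with h' | h' <;>
      simp [h, h']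

/-- `W(X,S)` is a finite group. -/
theorem finite_W [Finite X] : Finite (sol.W b) := by
  have hE : (Set.range b ∪ Set.range fun y => -b y).Finite :=
    (Set.finite_range _).union (Set.finite_range _)
  have : Finite ↑(Set.range b ∪ Set.range fun y => -b y) := hE
  have hmem : ∀ (w : sol.W b) (y : X),
      (w : V ≃ₗ[ℝ] V) (b y) ∈ Set.range b ∪ Set.range fun y => -b y := by
    rintro ⟨_, a, rfl⟩ y
    rcases sol.psi_apply b a y with h | h
    · exact Or.inl ⟨_, h.symm⟩
    · exact Or.inr ⟨_, h.symm⟩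
  refine Finite.of_injective (β := X → ↑(Set.range b ∪ Set.range fun y => -b y))
    (fun w y => ⟨_, hmem w y⟩) ?_
  intro w w' h
  apply Subtype.ext
  apply LinearEquiv.toLinearMap_injective
  apply b.ext
  intro y
  exact congrArg Subtype.val (congrFun h y)

/-- The set `{ψ_x | x ∈ X}` generates `W(X,S)` as a monoid, so that every element of `W(X,S)` is
represented by a word on it. -/
theorem closure_genSet [Finite X] : Submonoid.closure (sol.genSet b) = ⊤ := by
  have := sol.finite_W b
  rw [← Subgroup.closure_toSubmonoid_of_finite]
  have h : sol.genSet b =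
      (sol.psi b).rangeRestrict '' Set.range (PresentedGroup.of (rels := sol.groupRels)) := by
    rw [← Set.range_comp]
    rfl
  have h2 : Subgroup.closure (sol.genSet b) = ⊤ := by
    rw [h, ← MonoidHom.map_closure, PresentedGroup.closure_range_of, ← MonoidHom.range_eq_map,
      MonoidHom.range_eq_top]
    exact (sol.psi b).rangeRestrict_surjective
  rw [h2]
  rfl

end Representation

end YBSolution

/-- `n(ρ)` is the number of elements `x` of the basis `X` with `ρ(x) ∉ X`. -/
def signCount {X V : Type*} [AddCommGroup V] [Module ℝ V] (b : Module.Basis X ℝ V)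
    (ρ : V ≃ₗ[ℝ] V) : ℕ :=
  Set.ncard {x : X | ρ (b x) ∉ Set.range b}

end

/-! The proof rests on a cocycle `c : M → ℕ^X` with `c_x` the indicator of `x` and `c_{ab}(z) =
c_b(z) + c_a(φ_b(z))`. For finite `X` it is a bijection (`cocycle_surjective`, `cocycle_injective`)
that turns right divisibility into the pointwise order (`rightDivides_iff`) and length into the sum
of values. The minimal Garside element is then the `Δ` with `c_Δ = 1`, and its divisors on either
side are the `a` with `c_a ≤ 1` (`leftDivides_of_cocycle_eq_one`).

The sign of `ψ_a(y)` is `(-1)^{c_a(y)}` (`psiM_apply`), so `n(ψ_a)` counts the odd values of `c_a`.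
This count never exceeds the sum of values, and equals it when `c_a ≤ 1`; hence the three lengths
agree on divisors of `Δ`, and parities recover `a`. A length-additive factorization of `ψ_Δ` lifts
to a product in `M` with the image and length of `Δ`, hence to `Δ` itself. -/

theorem wordLength_le {W : Type*} [Monoid W] {A : Set W} {l : List W} (h : ∀ v ∈ l, v ∈ A) :
    wordLength A l.prod ≤ l.length :=
  Nat.sInf_le ⟨l, h, rfl, rfl⟩

theorem exists_list_length_eq_wordLength {W : Type*} [Monoid W] {A : Set W}
    (hA : Submonoid.closure A = ⊤) (w : W) :
    ∃ l : List W, (∀ v ∈ l, v ∈ A) ∧ l.prod = w ∧ l.length = wordLength A w := by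
  have hw : w ∈ Submonoid.closure A := hA ▸ Submonoid.mem_top w
  obtain ⟨l, hl, hlw⟩ := Submonoid.exists_list_of_mem_closure hw
  exact Nat.sInf_mem
    (s := {k : ℕ | ∃ l : List W, (∀ v ∈ l, v ∈ A) ∧ l.prod = w ∧ l.length = k})
    ⟨l.length, l, hl, hlw, rfl⟩

namespace YBSolution

variable {X : Type*} (sol : YBSolution X)

/-! ### Generators, length and `φ` on the monoid. -/

theorem phiGen_eq_iff (x y z : X) : sol.phiGen y z = x ↔ z = sol.f y x :=
  ⟨fun h => by rw [← h, f_phiGen], fun h => by rw [h, phiGen_f]⟩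

theorem phiGen_f_eq_g_iff (x y z : X) : sol.phiGen (sol.f y x) z = sol.g x y ↔ z = y := by
  rw [phiGen_eq_iff, f_g]

theorem gen_mul_gen (x y : X) :
    sol.gen x * sol.gen y = sol.gen (sol.g x y) * sol.gen (sol.f y x) := by
  by_cases h : sol.S (x, y) = (x, y)
  · have h1 : sol.g x y = x := congrArg Prod.fst h
    have h2 : sol.f y x = y := congrArg Prod.snd h
    rw [h1, h2]
  · exact PresentedMonoid.mk_eq_mk_of_rel ⟨x, y, h, rfl, rfl⟩

theorem g_phiGen (x y : X) : sol.g (sol.phiGen x y) x = sol.phiGen y x := by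
  rw [eq_comm, phiGen_eq_iff]
  have := sol.f_g (sol.phiGen x y) x
  rw [f_phiGen] at this
  exact this.symm

/-- Any two generators have a common left multiple of length two. -/
theorem gen_phiGen_mul_gen (x y : X) :
    sol.gen (sol.phiGen x y) * sol.gen x = sol.gen (sol.phiGen y x) * sol.gen y := by
  rw [gen_mul_gen, f_phiGen, g_phiGen]

theorem eq_one_or_exists_mul_gen (a : sol.M) : a = 1 ∨ ∃ a' x, a = a' * sol.gen x := by
  have h : a ∈ Submonoid.closure (Set.range sol.gen) :=
    (PresentedMonoid.closure_range_of sol.monoidRels).symm ▸ Submonoid.mem_top a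
  induction h using Submonoid.closure_induction_right with
  | one => exact Or.inl rfl
  | mul_right a _ x hx _ =>
    obtain ⟨x, rfl⟩ := hx
    exact Or.inr ⟨a, x, rfl⟩

theorem gen_induction {p : sol.M → Prop} (one : p 1)
    (mul_gen : ∀ a x, p a → p (a * sol.gen x)) (a : sol.M) : p a := by
  have h : a ∈ Submonoid.closure (Set.range sol.gen) :=
    (PresentedMonoid.closure_range_of sol.monoidRels).symm ▸ Submonoid.mem_top a
  induction h using Submonoid.closure_induction_right with
  | one => exact one
  | mul_right a _ x hx ih =>
    obtain ⟨x, rfl⟩ := hx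
    exact mul_gen a x ih

section Length

theorem len_one : sol.len 1 = 0 := rfl

theorem len_gen (x : X) : sol.len (sol.gen x) = 1 := rfl

theorem len_mul (a b : sol.M) : sol.len (a * b) = sol.len a + sol.len b := by
  simp [len]

theorem eq_one_of_len_eq_zero {a : sol.M} (h : sol.len a = 0) : a = 1 := by
  rcases sol.eq_one_or_exists_mul_gen a with h1 | ⟨a', x, rfl⟩
  · exact h1
  · simp [len_mul, len_gen] at h

/-- Generators are atoms: in a product of length one, some factor has length zero, hence is trivial.
So any generating set contains `X`. -/
theorem mem_of_mem_closure_of_len_eq_one {D : Set sol.M} {a : sol.M}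
    (ha : a ∈ Submonoid.closure D) (h : sol.len a = 1) : a ∈ D := by
  induction ha using Submonoid.closure_induction with
  | mem a ha => exact ha
  | one => simp [len_one] at h
  | mul a b _ _ iha ihb =>
    rw [len_mul] at h
    rcases Nat.eq_zero_or_pos (sol.len a) with h0 | h0
    · rw [sol.eq_one_of_len_eq_zero h0, one_mul]
      exact ihb (by omega)
    · rw [sol.eq_one_of_len_eq_zero (a := b) (by omega), mul_one]
      exact iha (by omega)

end Length

section Phi

theorem phiM_one : sol.phiM 1 = 1 := by simp [phiM]

theorem phiM_mul (a b : sol.M) : sol.phiM (a * b) = sol.phiM a * sol.phiM b := by simp [phiM]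

theorem phiM_gen (x : X) : sol.phiM (sol.gen x) = sol.phiGen x :=
  PresentedGroup.toGroup.of sol.phi_aux

end Phi

/-! ### The bijective cocycle from the monoid to `ℕ^X`. -/

section Cocycle

open Classical in
/-- The right action of a generator on `ℕ`-valued functions on `X`. -/
noncomputable def cocycleStep (x : X) : Function.End (X → ℕ) :=
  fun u z => (if z = x then 1 else 0) + u (sol.phiGen x z)

/-- Both sides add the indicators of `y` and `f_y(x)`, in opposite orders; the remaining
permutations agree by `phiGen_mul`. -/
theorem cocycleStep_cocycleStep (x y : X) (u : X → ℕ) :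
    sol.cocycleStep y (sol.cocycleStep x u) =
      sol.cocycleStep (sol.f y x) (sol.cocycleStep (sol.g x y) u) := by
  classical
  funext z
  have h := Equiv.congr_fun (sol.phiGen_mul x y) z
  simp only [Equiv.Perm.mul_apply] at h
  simp only [cocycleStep, phiGen_f_eq_g_iff, h]
  simp only [phiGen_eq_iff, ← add_assoc]
  rw [add_comm (if z = y then 1 else 0)]

theorem cocycleStep_rel (v w : FreeMonoid X) (h : sol.monoidRels v w) :
    FreeMonoid.lift (fun x => MulOpposite.op (sol.cocycleStep x)) v =
      FreeMonoid.lift (fun x => MulOpposite.op (sol.cocycleStep x)) w := by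
  obtain ⟨x, y, -, rfl, rfl⟩ := h
  simp only [map_mul, FreeMonoid.lift_eval_of, ← MulOpposite.op_mul]
  exact congrArg MulOpposite.op (funext (sol.cocycleStep_cocycleStep x y))

/-- The right action of `M(X,S)` on `ℕ`-valued functions on `X`. -/
noncomputable def cocycleAct : sol.M →* (Function.End (X → ℕ))ᵐᵒᵖ :=
  PresentedMonoid.lift (fun x => MulOpposite.op (sol.cocycleStep x)) sol.cocycleStep_rel

/-- The cocycle `M(X,S) → ℕ^X` that is one on `x` and zero elsewhere at a generator `x`. -/
noncomputable def cocycle (a : sol.M) : X → ℕ := (sol.cocycleAct a).unop 0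

/-- The action is affine: translation by the cocycle after precomposition with `φ_a`. Composing two
such maps gives the cocycle identity `cocycle_mul`. -/
theorem cocycleAct_apply (a : sol.M) (u : X → ℕ) (z : X) :
    (sol.cocycleAct a).unop u z = sol.cocycle a z + u (sol.phiM a z) := by
  induction a using sol.gen_induction generalizing z with
  | one => simp [cocycle, phiM_one, Function.End.one_def]
  | mul_gen a x ih =>
    have h : ∀ u, (sol.cocycleAct (a * sol.gen x)).unop u =
        sol.cocycleStep x ((sol.cocycleAct a).unop u) := by
      intro u
      rw [map_mul, MulOpposite.unop_mul]
      rfl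
    rw [cocycle, h, h, phiM_mul, phiM_gen, cocycleStep, cocycleStep, ih, ← cocycle,
      Equiv.Perm.mul_apply, add_assoc]

theorem cocycle_one : sol.cocycle 1 = 0 := by
  simp [cocycle, Function.End.one_def]

theorem cocycle_mul (a b : sol.M) (z : X) :
    sol.cocycle (a * b) z = sol.cocycle b z + sol.cocycle a (sol.phiM b z) := by
  rw [← cocycleAct_apply, cocycle, map_mul, MulOpposite.unop_mul]
  rfl

theorem cocycle_gen_self (x : X) : sol.cocycle (sol.gen x) x = 1 := by
  change sol.cocycleStep x 0 x = 1
  simp [cocycleStep]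

theorem cocycle_gen_of_ne {x z : X} (h : z ≠ x) : sol.cocycle (sol.gen x) z = 0 := by
  change sol.cocycleStep x 0 z = 0
  simp [cocycleStep, h]

theorem sum_cocycle_gen [Fintype X] (x : X) : ∑ z, sol.cocycle (sol.gen x) z = 1 := by
  rw [Fintype.sum_eq_single x fun z hz => sol.cocycle_gen_of_ne hz, cocycle_gen_self]

theorem len_eq_sum_cocycle [Fintype X] (a : sol.M) : sol.len a = ∑ z, sol.cocycle a z := by
  induction a using sol.gen_induction with
  | one => simp [len_one, cocycle_one]
  | mul_gen a x ih =>
    simp only [len_mul, cocycle_mul, Finset.sum_add_distrib, sum_cocycle_gen, len_gen,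
      Equiv.sum_comp, ih]
    exact add_comm _ _

theorem cocycle_gen_le {x : X} {u : X → ℕ} (h : 0 < u x) : sol.cocycle (sol.gen x) ≤ u := by
  intro z
  by_cases hz : z = x
  · rw [hz, cocycle_gen_self]
    exact h
  · rw [sol.cocycle_gen_of_ne hz]
    exact Nat.zero_le _

/-- Right division in `ℕ^X` by the cocycle of `b`. -/
theorem exists_shift_of_cocycle_le {b : sol.M} {u : X → ℕ} (h : sol.cocycle b ≤ u) :
    ∃ v : X → ℕ, ∀ z, u z = sol.cocycle b z + v (sol.phiM b z) := by
  refine ⟨fun z => u ((sol.phiM b).symm z) - sol.cocycle b ((sol.phiM b).symm z), fun z => ?_⟩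
  simp only [Equiv.symm_apply_apply]
  exact (Nat.add_sub_cancel' (h z)).symm

/-- Induction on the sum of values: a point `x` of the support allows `gen x` to be split off on the
right, which lowers the sum by one. -/
theorem cocycle_surjective [Finite X] : Function.Surjective sol.cocycle := by
  cases nonempty_fintype X
  intro u
  induction hn : ∑ z, u z generalizing u with
  | zero =>
    refine ⟨1, ?_⟩
    rw [Finset.sum_eq_zero_iff] at hn
    funext z
    rw [cocycle_one, hn z (Finset.mem_univ z), Pi.zero_apply]
  | succ n ih =>
    obtain ⟨x, -, hx⟩ : ∃ x ∈ Finset.univ, u x ≠ 0 := by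
      by_contra! h
      rw [Finset.sum_eq_zero h] at hn
      omega
    obtain ⟨v, hv⟩ := sol.exists_shift_of_cocycle_le (sol.cocycle_gen_le (Nat.pos_of_ne_zero hx))
    have hsum : ∑ z, v z = n := by
      simp only [hv, Finset.sum_add_distrib, sum_cocycle_gen, Equiv.sum_comp] at hn
      omega
    obtain ⟨a, rfl⟩ := ih v hsum
    exact ⟨a * sol.gen x, funext fun z => by rw [cocycle_mul, hv]⟩

theorem exists_cocycle_mul_eq [Finite X] {b : sol.M} {u : X → ℕ} (h : sol.cocycle b ≤ u) :
    ∃ a, sol.cocycle (a * b) = u := by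
  obtain ⟨v, hv⟩ := sol.exists_shift_of_cocycle_le h
  obtain ⟨a, rfl⟩ := sol.cocycle_surjective v
  exact ⟨a, funext fun z => by rw [cocycle_mul, hv]⟩

theorem cocycle_left_cancel {a a' b : sol.M}
    (h : sol.cocycle (a * b) = sol.cocycle (a' * b)) : sol.cocycle a = sol.cocycle a' := by
  funext z
  have := congrFun h ((sol.phiM b).symm z)
  simpa only [cocycle_mul, Equiv.apply_symm_apply, add_right_inj] using this

/-- Induction on length. If the last letters `x ≠ y` differ, the common cocycle is positive at both,
so it dominates that of the common left multiple of `gen x` and `gen y`. Surjectivity supplies a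
quotient `d`, and the induction hypothesis identifies both prefixes in terms of `d`. -/
theorem cocycle_injective [Finite X] : Function.Injective sol.cocycle := by
  cases nonempty_fintype X
  intro a b h
  induction hn : sol.len a generalizing a b with
  | zero =>
    have hb : sol.len b = 0 := by rw [len_eq_sum_cocycle, ← h, ← len_eq_sum_cocycle, hn]
    rw [sol.eq_one_of_len_eq_zero hn, sol.eq_one_of_len_eq_zero hb]
  | succ n ih =>
    have hb : sol.len b = n + 1 := by rw [len_eq_sum_cocycle, ← h, ← len_eq_sum_cocycle, hn]
    rcases sol.eq_one_or_exists_mul_gen a with rfl | ⟨a, x, rfl⟩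
    · simp [len_one] at hn
    rcases sol.eq_one_or_exists_mul_gen b with rfl | ⟨b, y, rfl⟩
    · simp [len_one] at hb
    rw [len_mul, len_gen, Nat.add_right_cancel_iff] at hn hb
    by_cases hxy : x = y
    · subst hxy
      rw [ih (sol.cocycle_left_cancel h) hn]
    -- The left side is the indicator of `{x, y}`.
    have hle : sol.cocycle (sol.gen (sol.phiGen x y) * sol.gen x) ≤
        sol.cocycle (a * sol.gen x) := by
      refine Pi.le_def.2 fun z => ?_
      rw [cocycle_mul]
      by_cases hzx : z = x
      · subst hzx
        rw [cocycle_mul, cocycle_gen_self, phiM_gen,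
          sol.cocycle_gen_of_ne fun h => hxy ((sol.phiGen z).injective h)]
        omega
      by_cases hzy : z = y
      · subst hzy
        rw [h, cocycle_mul, phiM_gen, cocycle_gen_self, cocycle_gen_self,
          sol.cocycle_gen_of_ne hzx]
        omega
      · rw [phiM_gen, sol.cocycle_gen_of_ne hzx,
          sol.cocycle_gen_of_ne fun h => hzy ((sol.phiGen x).injective h)]
        exact Nat.zero_le _
    obtain ⟨d, hd⟩ := sol.exists_cocycle_mul_eq hle
    have ha : a = d * sol.gen (sol.phiGen x y) :=
      ih (sol.cocycle_left_cancel (b := sol.gen x) (by rw [mul_assoc, hd])) hn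
    have hb' : b = d * sol.gen (sol.phiGen y x) :=
      (ih (sol.cocycle_left_cancel (b := sol.gen y)
        (by rw [mul_assoc, ← gen_phiGen_mul_gen, hd, h])) (by
          rw [len_mul, len_gen]
          rw [ha, len_mul, len_gen] at hn
          exact hn)).symm
    rw [ha, hb', mul_assoc, mul_assoc, gen_phiGen_mul_gen]

theorem rightDivides_iff [Finite X] {a b : sol.M} :
    RightDivides b a ↔ sol.cocycle b ≤ sol.cocycle a := by
  constructor
  · rintro ⟨h, rfl⟩ z
    rw [cocycle_mul]
    exact Nat.le_add_right _ _
  · intro h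
    obtain ⟨d, hd⟩ := sol.exists_cocycle_mul_eq h
    exact ⟨d, sol.cocycle_injective hd.symm⟩

theorem rightDivides_gen_iff [Finite X] {a : sol.M} {x : X} :
    RightDivides (sol.gen x) a ↔ 0 < sol.cocycle a x := by
  rw [rightDivides_iff]
  refine ⟨fun h => ?_, sol.cocycle_gen_le⟩
  have := h x
  rw [cocycle_gen_self] at this
  exact this

/-- Cancellation in the symmetric group gives `φ_b = φ_b'`, so the contributions of `a` to the two
cocycles coincide and drop out. -/
theorem mul_left_cancel_M [Finite X] {a b b' : sol.M} (h : a * b = a * b') : b = b' := by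
  apply sol.cocycle_injective
  have hphi : sol.phiM b = sol.phiM b' := by
    have := congrArg sol.phiM h
    rwa [phiM_mul, phiM_mul, mul_right_inj] at this
  funext z
  have := congrFun (congrArg sol.cocycle h) z
  rwa [cocycle_mul, cocycle_mul, hphi, add_left_inj] at this

theorem finite_cocycle_le [Finite X] (u : X → ℕ) : {a : sol.M | sol.cocycle a ≤ u}.Finite :=
  by
  have : (Set.Iic u).Finite :=
    (Set.Finite.pi' fun z => Set.finite_Iic (u z)).subset fun _ h => h
  exact this.preimage sol.cocycle_injective.injOn

end Cocycle

/-! ### Garside elements read through the cocycle. -/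

section Garside

variable {sol} {Δ : sol.M}

theorem rightDivides_of_cocycle_eq_one [Finite X] (hΔ : sol.cocycle Δ = 1) {a : sol.M} :
    RightDivides a Δ ↔ sol.cocycle a ≤ 1 := by
  rw [rightDivides_iff, hΔ]

/-- If `Δ = a d`, the value of the cocycle of `a` at `z` is a summand of that of `Δ` at `φ_d⁻¹(z)`.
-/
theorem cocycle_le_one_of_leftDivides (hΔ : sol.cocycle Δ = 1) {a : sol.M}
    (h : LeftDivides a Δ) : sol.cocycle a ≤ 1 := by
  obtain ⟨d, rfl⟩ := h
  intro z
  have := congrFun hΔ ((sol.phiM d).symm z)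
  rw [cocycle_mul, Equiv.apply_symm_apply] at this
  exact this ▸ Nat.le_add_left _ _

/-- Pigeonhole: sending a right divisor `d` to a complement `a` with `Δ = a d` maps the finite set
`D` to itself, injectively by left cancellation. Hence every element of `D` is a complement, that
is, a left divisor. -/
theorem leftDivides_of_cocycle_eq_one [Finite X] (hΔ : sol.cocycle Δ = 1) {a : sol.M} :
    LeftDivides a Δ ↔ sol.cocycle a ≤ 1 := by
  refine ⟨cocycle_le_one_of_leftDivides hΔ, fun ha => ?_⟩
  let D := {a : sol.M | sol.cocycle a ≤ 1}
  have : Finite D := sol.finite_cocycle_le 1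
  have hex : ∀ d : D, ∃ a : D, Δ = a * d := fun d => by
    obtain ⟨a, h⟩ := (rightDivides_of_cocycle_eq_one hΔ).2 d.2
    exact ⟨⟨a, cocycle_le_one_of_leftDivides hΔ ⟨d, h⟩⟩, h⟩
  choose F hF using hex
  have hinj : Function.Injective F := fun d d' h =>
    Subtype.ext (sol.mul_left_cancel_M (a := (F d : sol.M)) (by rw [← hF d, h, ← hF d']))
  obtain ⟨d, hd⟩ := (Finite.surjective_of_injective hinj) ⟨a, ha⟩
  exact ⟨d, by rw [hF d, hd]⟩

theorem mem_divisorSet_of_cocycle_eq_one [Finite X] (hΔ : sol.cocycle Δ = 1) {a : sol.M} :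
    a ∈ divisorSet Δ ↔ sol.cocycle a ≤ 1 :=
  leftDivides_of_cocycle_eq_one hΔ

theorem isBalanced_of_cocycle_eq_one [Finite X] (hΔ : sol.cocycle Δ = 1) : IsBalanced Δ :=
  fun _ => by rw [leftDivides_of_cocycle_eq_one hΔ, rightDivides_of_cocycle_eq_one hΔ]

theorem isGarsideElement_of_cocycle_eq_one [Finite X] (hΔ : sol.cocycle Δ = 1) :
    IsGarsideElement Δ := by
  refine ⟨isBalanced_of_cocycle_eq_one hΔ, ?_⟩
  rw [← top_le_iff, ← PresentedMonoid.closure_range_of sol.monoidRels]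
  apply Submonoid.closure_mono
  rintro _ ⟨x, rfl⟩
  exact (mem_divisorSet_of_cocycle_eq_one hΔ).2 (sol.cocycle_gen_le Nat.one_pos)

/-- The divisors generate, so they contain the atoms; being balanced makes each atom a right
divisor. -/
theorem one_le_cocycle_of_isGarsideElement [Finite X] {e : sol.M} (he : IsGarsideElement e) :
    1 ≤ sol.cocycle e := by
  intro x
  have hx : sol.gen x ∈ divisorSet e :=
    sol.mem_of_mem_closure_of_len_eq_one (he.2.symm ▸ Submonoid.mem_top _) (sol.len_gen x)
  exact sol.rightDivides_gen_iff.1 ((he.1 _).1 hx)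

theorem isMinGarsideElement_iff [Finite X] : IsMinGarsideElement Δ ↔ sol.cocycle Δ = 1 := by
  constructor
  · intro h
    obtain ⟨δ, hδ⟩ := sol.cocycle_surjective 1
    apply le_antisymm _ (one_le_cocycle_of_isGarsideElement h.1)
    rw [← hδ]
    exact sol.rightDivides_iff.1 (h.2 δ (isGarsideElement_of_cocycle_eq_one hδ)).2
  · intro h
    refine ⟨isGarsideElement_of_cocycle_eq_one h, fun e he => ?_⟩
    have hr : RightDivides Δ e := by
      rw [rightDivides_iff, h]
      exact one_le_cocycle_of_isGarsideElement he
    exact ⟨(he.1 Δ).2 hr, hr⟩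

end Garside

/-! ### Signs, word length and factors in `W`. -/

section Signs

variable {V : Type*} [AddCommGroup V] [Module ℝ V] (b : Module.Basis X ℝ V)

theorem psiM_one : sol.psiM b 1 = 1 := by simp [psiM]

theorem psiM_mul (a a' : sol.M) : sol.psiM b (a * a') = sol.psiM b a * sol.psiM b a' := by
  simp [psiM]

theorem coe_psiM_gen (x : X) : (sol.psiM b (sol.gen x) : V ≃ₗ[ℝ] V) = sol.psiGen b x :=
  PresentedGroup.toGroup.of (sol.psi_aux b)

theorem psiGen_apply (x y : X) :
    sol.psiGen b x (b y) = (-1 : ℝ) ^ sol.cocycle (sol.gen x) y • b (sol.phiGen x y) := by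
  by_cases h : y = x
  · subst h
    rw [psiGen_self, cocycle_gen_self, pow_one, neg_one_smul]
  · rw [sol.psiGen_of_ne b h, sol.cocycle_gen_of_ne h, pow_zero, one_smul]

/-- The sign of `ψ_a(y)` is the parity of the cocycle of `a` at `y`. -/
theorem psiM_apply (a : sol.M) (y : X) :
    (sol.psiM b a : V ≃ₗ[ℝ] V) (b y) = (-1 : ℝ) ^ sol.cocycle a y • b (sol.phiM a y) := by
  induction a using sol.gen_induction generalizing y with
  | one => simp [psiM_one, cocycle_one, phiM_one]
  | mul_gen a x ih =>
    rw [psiM_mul, Subgroup.coe_mul, LinearEquiv.mul_apply, coe_psiM_gen, psiGen_apply, map_smul,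
      ih, smul_smul, cocycle_mul, pow_add, phiM_mul, phiM_gen, Equiv.Perm.mul_apply]

theorem basis_ne_neg (x y : X) : b x ≠ -b y := by
  intro h
  have h1 := DFunLike.congr_fun (congrArg b.repr h) x
  rw [map_neg, Finsupp.neg_apply, b.repr_self, b.repr_self, Finsupp.single_eq_same] at h1
  rcases eq_or_ne y x with rfl | hne
  · rw [Finsupp.single_eq_same] at h1
    norm_num at h1
  · rw [Finsupp.single_eq_of_ne hne.symm] at h1
    norm_num at h1

theorem psiM_apply_mem_range_iff (a : sol.M) (x : X) :
    (sol.psiM b a : V ≃ₗ[ℝ] V) (b x) ∈ Set.range b ↔ Even (sol.cocycle a x) := by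
  rw [psiM_apply]
  rcases Nat.even_or_odd (sol.cocycle a x) with h | h
  · simp [h.neg_one_pow, h]
  · rw [h.neg_one_pow, neg_one_smul]
    refine iff_of_false ?_ (Nat.not_even_iff_odd.2 h)
    rintro ⟨y, hy⟩
    exact basis_ne_neg b _ _ hy

theorem signCount_psiM (a : sol.M) :
    signCount b (sol.psiM b a) = Set.ncard {x | Odd (sol.cocycle a x)} := by
  simp only [signCount, psiM_apply_mem_range_iff, Nat.not_even_iff_odd]

theorem ncard_odd_le [Fintype X] (u : X → ℕ) : Set.ncard {x | Odd (u x)} ≤ ∑ x, u x := by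
  classical
  rw [Set.ncard_eq_toFinset_card', Set.toFinset_ofPred, Finset.card_filter]
  refine Finset.sum_le_sum fun x _ => ?_
  split_ifs with h
  · exact h.pos
  · exact Nat.zero_le _

theorem ncard_odd_eq [Fintype X] {u : X → ℕ} (hu : u ≤ 1) :
    Set.ncard {x | Odd (u x)} = ∑ x, u x := by
  classical
  rw [Set.ncard_eq_toFinset_card', Set.toFinset_ofPred, Finset.card_filter]
  refine Finset.sum_congr rfl fun x _ => ?_
  have h1 : u x ≤ 1 := hu x
  interval_cases u x <;> simp

/-- A word on `ψ(X)` lifts to `M(X,S)`. -/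
theorem exists_psiM_eq_prod (l : List (sol.W b)) (hl : ∀ v ∈ l, v ∈ sol.genSet b) :
    ∃ a, sol.psiM b a = l.prod ∧ sol.len a = l.length := by
  induction l with
  | nil => exact ⟨1, by rw [psiM_one, List.prod_nil], sol.len_one⟩
  | cons v l ih =>
    obtain ⟨a, ha, hlen⟩ := ih fun w hw => hl w (List.mem_cons_of_mem _ hw)
    obtain ⟨x, rfl⟩ := hl v List.mem_cons_self
    refine ⟨sol.gen x * a, by rw [psiM_mul, ha, List.prod_cons], ?_⟩
    rw [len_mul, len_gen, hlen, List.length_cons, add_comm]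

theorem exists_psiM_eq [Finite X] (w : sol.W b) :
    ∃ a, sol.psiM b a = w ∧ sol.len a = wordLength (sol.genSet b) w := by
  obtain ⟨l, hl, rfl, hlen⟩ := exists_list_length_eq_wordLength (sol.closure_genSet b) w
  rw [← hlen]
  exact sol.exists_psiM_eq_prod b l hl

theorem wordLength_psiM_le (a : sol.M) : wordLength (sol.genSet b) (sol.psiM b a) ≤ sol.len a := by
  suffices h : ∃ l : List (sol.W b), (∀ v ∈ l, v ∈ sol.genSet b) ∧ l.prod = sol.psiM b a ∧
      l.length = sol.len a by
    obtain ⟨l, hl, h1, h2⟩ := h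
    rw [← h1, ← h2]
    exact wordLength_le hl
  induction a using sol.gen_induction with
  | one => exact ⟨[], by simp, by simp [psiM_one], by simp [len_one]⟩
  | mul_gen a x ih =>
    obtain ⟨l, hl, h1, h2⟩ := ih
    refine ⟨l ++ [sol.psiM b (sol.gen x)], ?_, by simp [h1, psiM_mul], by
      simp [h2, len_mul, len_gen]⟩
    intro v hv
    rcases List.mem_append.1 hv with hv | hv
    · exact hl v hv
    · rw [List.mem_singleton.1 hv]
      exact ⟨x, rfl⟩

/-- Lift a shortest word to the monoid: the number of odd cocycle values is at most their sum, the
length. -/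
theorem signCount_le_wordLength [Finite X] (w : sol.W b) :
    signCount b w ≤ wordLength (sol.genSet b) w := by
  cases nonempty_fintype X
  obtain ⟨a, rfl, ha⟩ := sol.exists_psiM_eq b w
  rw [← ha, signCount_psiM, len_eq_sum_cocycle]
  exact ncard_odd_le _

variable {sol}

theorem signCount_psiM_eq_len [Finite X] {a : sol.M} (ha : sol.cocycle a ≤ 1) :
    signCount b (sol.psiM b a) = sol.len a := by
  cases nonempty_fintype X
  rw [signCount_psiM, len_eq_sum_cocycle, ncard_odd_eq ha]

/-- The word length is squeezed between `signCount` and `len`, which agree when the cocycle is at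
most one. -/
theorem wordLength_psiM_eq_len [Finite X] {a : sol.M} (ha : sol.cocycle a ≤ 1) :
    wordLength (sol.genSet b) (sol.psiM b a) = sol.len a :=
  le_antisymm (sol.wordLength_psiM_le b a)
    (signCount_psiM_eq_len b ha ▸ sol.signCount_le_wordLength b _)

/-- The image determines the parities of the cocycle, and values at most one are determined by
parity. -/
theorem psiM_injOn [Finite X] : Set.InjOn (sol.psiM b) {a | sol.cocycle a ≤ 1} := by
  intro a ha a' ha' h
  apply sol.cocycle_injective
  funext x
  have h1 := sol.psiM_apply_mem_range_iff b a x
  rw [h, psiM_apply_mem_range_iff] at h1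
  have h2 : sol.cocycle a x ≤ 1 := ha x
  have h3 : sol.cocycle a' x ≤ 1 := ha' x
  rw [Nat.even_iff, Nat.even_iff] at h1
  omega

/-- An element of `M(X,S)` with the length and the image of `Δ` is `Δ`. -/
theorem eq_of_psiM_eq_of_len_eq [Finite X] {Δ a : sol.M} (hΔ : sol.cocycle Δ = 1)
    (h : sol.psiM b a = sol.psiM b Δ) (hlen : sol.len a = sol.len Δ) : a = Δ := by
  cases nonempty_fintype X
  apply sol.cocycle_injective
  rw [hΔ]
  -- Each value is odd, hence at least one; as the values sum to the length of `Δ`, all equal one.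
  have hpos : ∀ x ∈ Finset.univ, (1 : X → ℕ) x ≤ sol.cocycle a x := fun x _ => by
    have h1 := sol.psiM_apply_mem_range_iff b a x
    rw [h, psiM_apply_mem_range_iff, hΔ] at h1
    exact (Nat.not_even_iff_odd.1 fun h2 => by simpa using h1.2 h2).pos
  rw [len_eq_sum_cocycle, len_eq_sum_cocycle, hΔ] at hlen
  funext x
  exact ((Finset.sum_eq_sum_iff_of_le hpos).1 hlen.symm x (Finset.mem_univ x)).symm

/-- Shortest words for `v` and `u` lift to `a` and `d`; additivity of lengths gives `a * d` the
length of `Δ`, so `eq_of_psiM_eq_of_len_eq` applies. -/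
theorem exists_mul_eq_of_factor [Finite X] {Δ : sol.M} (hΔ : sol.cocycle Δ = 1)
    {v u : sol.W b} (h : sol.psiM b Δ = v * u)
    (hlen : wordLength (sol.genSet b) (sol.psiM b Δ) =
      wordLength (sol.genSet b) v + wordLength (sol.genSet b) u) :
    ∃ a d, sol.psiM b a = v ∧ sol.psiM b d = u ∧ Δ = a * d := by
  obtain ⟨a, rfl, ha⟩ := sol.exists_psiM_eq b v
  obtain ⟨d, rfl, hd⟩ := sol.exists_psiM_eq b u
  refine ⟨a, d, rfl, rfl, (eq_of_psiM_eq_of_len_eq b hΔ ?_ ?_).symm⟩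
  · rw [psiM_mul, h]
  · rw [len_mul, ha, hd, ← hlen, wordLength_psiM_eq_len b hΔ.le]

theorem wordLength_psiM_mul [Finite X] {a d : sol.M} (h : sol.cocycle (a * d) = 1) :
    wordLength (sol.genSet b) (sol.psiM b (a * d)) =
      wordLength (sol.genSet b) (sol.psiM b a) + wordLength (sol.genSet b) (sol.psiM b d) := by
  rw [wordLength_psiM_eq_len b h.le,
    wordLength_psiM_eq_len b (cocycle_le_one_of_leftDivides h ⟨d, rfl⟩),
    wordLength_psiM_eq_len b ((rightDivides_of_cocycle_eq_one h).1 ⟨a, rfl⟩), len_mul]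

theorem leftFactors_psiM [Finite X] {Δ : sol.M} (hΔ : sol.cocycle Δ = 1) :
    leftFactors (sol.genSet b) (sol.psiM b Δ) = sol.psiM b '' {a | LeftDivides a Δ} := by
  apply Set.Subset.antisymm
  · rintro v ⟨u, h, hlen⟩
    obtain ⟨a, d, rfl, -, had⟩ := exists_mul_eq_of_factor b hΔ h hlen
    exact ⟨a, ⟨d, had⟩, rfl⟩
  · rintro _ ⟨a, ⟨d, rfl⟩, rfl⟩
    exact ⟨sol.psiM b d, sol.psiM_mul b a d, wordLength_psiM_mul b hΔ⟩

theorem rightFactors_psiM [Finite X] {Δ : sol.M} (hΔ : sol.cocycle Δ = 1) :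
    rightFactors (sol.genSet b) (sol.psiM b Δ) = sol.psiM b '' {a | RightDivides a Δ} := by
  apply Set.Subset.antisymm
  · rintro v ⟨u, h, hlen⟩
    obtain ⟨a, d, -, rfl, had⟩ := exists_mul_eq_of_factor b hΔ h hlen
    exact ⟨d, ⟨a, had⟩, rfl⟩
  · rintro _ ⟨d, ⟨a, rfl⟩, rfl⟩
    exact ⟨sol.psiM b a, sol.psiM_mul b a d, wordLength_psiM_mul b hΔ⟩

theorem isFactorBalanced_psiM [Finite X] {Δ : sol.M} (hΔ : sol.cocycle Δ = 1) :
    IsFactorBalanced (sol.genSet b) (sol.psiM b Δ) := by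
  rw [IsFactorBalanced, leftFactors_psiM b hΔ, rightFactors_psiM b hΔ]
  exact congrArg _ (Set.ext (isBalanced_of_cocycle_eq_one hΔ))

end Signs

end YBSolution

open YBSolution in
theorem mainTheorem6 {X : Type*} [Finite X] (sol : YBSolution X)
    {V : Type*} [AddCommGroup V] [Module ℝ V] (b : Module.Basis X ℝ V) :
    (∃! Δ : sol.M, IsMinGarsideElement Δ) ∧
    ∀ Δ : sol.M, IsMinGarsideElement Δ →
      (∀ a ∈ divisorSet Δ,
        (sol.len a = wordLength (sol.genSet b) (sol.psiM b a) ∧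
          wordLength (sol.genSet b) (sol.psiM b a) = signCount b (sol.psiM b a)) ∧
        ∀ x : X,
          (RightDivides (sol.gen x) a →
            (sol.psiM b a : V ≃ₗ[ℝ] V) (b x) = -b (sol.phiM a x)) ∧
          (¬ RightDivides (sol.gen x) a →
            (sol.psiM b a : V ≃ₗ[ℝ] V) (b x) = b (sol.phiM a x))) ∧
      Set.InjOn (sol.psiM b) (divisorSet Δ) ∧
      (IsFactorBalanced (sol.genSet b) (sol.psiM b Δ) ∧
        leftFactors (sol.genSet b) (sol.psiM b Δ) = sol.psiM b '' divisorSet Δ) := by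
  simp only [isMinGarsideElement_iff]
  refine ⟨?_, fun Δ hΔ => ⟨fun a ha => ?_, ?_, isFactorBalanced_psiM b hΔ,
    leftFactors_psiM b hΔ⟩⟩
  · obtain ⟨Δ, hΔ⟩ := sol.cocycle_surjective 1
    exact ⟨Δ, hΔ, fun e he => sol.cocycle_injective (he.trans hΔ.symm)⟩
  · rw [mem_divisorSet_of_cocycle_eq_one hΔ] at ha
    refine ⟨⟨(wordLength_psiM_eq_len b ha).symm, ?_⟩, fun x => ?_⟩
    · rw [wordLength_psiM_eq_len b ha, signCount_psiM_eq_len b ha]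
    · have hx : sol.cocycle a x ≤ 1 := ha x
      rw [rightDivides_gen_iff, psiM_apply]
      constructor
      · intro h
        rw [show sol.cocycle a x = 1 by omega, pow_one, neg_one_smul]
      · intro h
        rw [show sol.cocycle a x = 0 by omega, pow_zero, one_smul]
  · exact (psiM_injOn b).mono fun a ha => (mem_divisorSet_of_cocycle_eq_one hΔ).1 ha
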